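/- Graphs are finite, undirected and loopless, and may have parallel edges. A graph is biconnected if it is connected and has no cut vertex; a biconnected component (block) is a maximal biconnected subgraph. For $X\subseteq V(G)$ let $\partial(X)$ be the set of vertices of $X$ that have a neighbour in $V(G)\setminus X$. An instance $(G,S,k)$ of Disjoint $K_4$-minor cover consists of a graph $G$, a set $S\subseteq V(G)$ such that $G-S$ has no $K_4$ minor, and an integer $k$. Put $F=V(G)\setminus S$ and let $N_S(v)$ be the set of neighbours of $v$ in $S$. A graph is series-parallel if it arises, for some pair of terminals, from single edges by successive series and parallel compositions of two-terminal graphs. The instance admits a reduction rule if at least one of the following holds. 1. (1-boundary rule) There is $X\subseteq F$ such that $G[X]$ is a connected component of $G$ or of $G\setminus e$ for some cut edge $e$, or such that $|\partial(X)|=1$ and $X\neq\partial(X)$. 2. (Bypassing rule) Some $v\in F$ has degree two and two distinct neighbours $u_1\in V(G)$ and $u_2\in F$. 3. (Parallel rule) There is more than one edge between some $u\in V(G)$ and some $v\in F$. 4. (Chandelier rule) There are $\ell\ge 4$, a path $u_1,\dots,u_\ell$ in $G[F]$ and $x\in S$ such that $N_S(u_i)=\{x\}$ for all $i$ and $u_2,\dots,u_{\ell-1}$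 have degree exactly $3$ in $G$. 5. (2-boundary rule) There is $X\subseteq F$ such that $G[X]$ is connected, $\partial(X)=\{s,t\}$ with $s\ne t$, and either $G[X]+(s,t)$ is series-parallel and $|X|>2$, or $G[X]+(s,t)$ is not series-parallel and $|X|>4$. The instance admits a branching rule on a connected subset of $F$ if there is $X\subseteq F$ with $G[X]$ connected (and nonempty) such that at least one of the following holds. 1. $G[S\cup X]$ contains a subdivision of $K_4$. 2. Two vertices of $S$, each with a neighbour in $X$, lie in different connected components of $G[S]$. 3. Two vertices of $S$, each with a neighbour in $X$, lie in the same connected component of $G[S]$ but in no common biconnected component of $G[S]$. **Theorem.** Let $(G,S,k)$ be an instance of Disjoint $K_4$-minor cover that admits no reduction rule and no branching rule on a connected subset of $F$. Then $(G,S,k)$ is an independent instance, that is: (a) $F$ is an independent set of $G$; (b) every vertex of $F$ has exactly two neighbours in $S$; (c) for every vertex of $F$, its two neighbours in $S$ belong to the same biconnected component of $G[S]$; (d) $G[S\cup\{x\}]$ has no $K_4$ minor, for every $x\in F$. -/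

import Mathlib

/-! Multigraphs are Mathlib's `Graph α β` (vertices in `α`, edges labelled by `β`). -/

namespace K4Cover

variable {α β : Type*}

/-! ### Paths, connectivity, blocks -/

/-- The simple graph with the same adjacency between distinct vertices; it carries the walks and
paths of the multigraph `G`. -/
def toSimple (G : Graph α β) : SimpleGraph α where
  Adj x y := x ≠ y ∧ G.Adj x y
  symm := ⟨fun _ _ h => ⟨h.1.symm, h.2.symm⟩⟩
  loopless := ⟨fun _ h => h.1 rfl⟩

/-- `x` and `y` are vertices of the same connected component of `G`. -/
def SameComponent (G : Graph α β) (x y : α) : Prop :=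
  x ∈ G.vertexSet ∧ y ∈ G.vertexSet ∧ (toSimple G).Reachable x y

/-- `G` is connected (in particular it has a vertex). -/
def IsConnected (G : Graph α β) : Prop :=
  G.vertexSet.Nonempty ∧ ∀ x ∈ G.vertexSet, ∀ y ∈ G.vertexSet, SameComponent G x y

/-- `C` is the vertex set of a connected component of `G`. -/
def IsComponent (G : Graph α β) (C : Set α) : Prop :=
  ∃ v ∈ G.vertexSet, C = {w | SameComponent G v w}

/-- Deleting the vertex `v` increases the number of components: it separates two other vertices
that lie in the same component of `G`. -/
def IsCutVertex (G : Graph α β) (v : α) : Prop :=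
  v ∈ G.vertexSet ∧ ∃ x y, x ≠ v ∧ y ≠ v ∧ SameComponent G x y ∧
    ¬ SameComponent (G.deleteVerts {v}) x y

/-- Deleting the edge `e` increases the number of components: it separates the ends of `e`. -/
def IsCutEdge (G : Graph α β) (e : β) : Prop :=
  ∃ x y, G.IsLink e x y ∧ ¬ SameComponent (G.deleteEdges {e}) x y

/-- A connected graph without a cut vertex. -/
def IsBiconnected (G : Graph α β) : Prop :=
  IsConnected G ∧ ∀ v, ¬ IsCutVertex G v

/-- `B` is a block (biconnected component) of `G`: a maximal biconnected subgraph. -/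
def IsBlock (G B : Graph α β) : Prop :=
  Maximal (fun H : Graph α β => H ≤ G ∧ IsBiconnected H) B

/-! ### Minors and subdivisions of `K₄` -/

/-- `K₄` is a minor of `G`: there are four disjoint connected branch sets, any two of which are
joined by an edge. -/
def HasK4Minor (G : Graph α β) : Prop :=
  ∃ B : Fin 4 → Set α,
    (∀ i, B i ⊆ G.vertexSet ∧ IsConnected (G.induce (B i))) ∧
    (∀ i j, i ≠ j → Disjoint (B i) (B j)) ∧
    ∀ i j, i ≠ j → ∃ x ∈ B i, ∃ y ∈ B j, G.Adj x y

/-- `G` contains a subdivision of `K₄`: four distinct branching nodes, any two of which are joined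
by a path, where a path contains no further branching node and two different paths meet in
branching nodes only. -/
def HasK4Subdivision (G : Graph α β) : Prop :=
  ∃ (b : Fin 4 → α) (p : ∀ i j : Fin 4, i < j → (toSimple G).Walk (b i) (b j)),
    Function.Injective b ∧
    (∀ i j (h : i < j), (p i j h).IsPath) ∧
    (∀ i j (h : i < j) (m : Fin 4), b m ∈ (p i j h).support → m = i ∨ m = j) ∧
    ∀ i j (h : i < j) (k l) (h' : k < l), (i, j) ≠ (k, l) →
      ∀ x, x ∈ (p i j h).support → x ∈ (p k l h').support → ∃ m, x = b m

/-- `W` is a `K₄`-minor cover of `G`. -/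
def IsK4MinorCover (G : Graph α β) (W : Set α) : Prop :=
  W ⊆ G.vertexSet ∧ ¬ HasK4Minor (G.deleteVerts W)

/-! ### Series-parallel graphs -/

/-- `G` is the union of its edge-disjoint subgraphs `G₁` and `G₂`. -/
def IsEdgeDisjointUnion (G G₁ G₂ : Graph α β) : Prop :=
  G₁ ≤ G ∧ G₂ ≤ G ∧ G.vertexSet = G₁.vertexSet ∪ G₂.vertexSet ∧
    G.edgeSet = G₁.edgeSet ∪ G₂.edgeSet ∧ Disjoint G₁.edgeSet G₂.edgeSet

/-- `(G, s, t)` is a two-terminal series-parallel graph: these are formed from single edges by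
series and parallel compositions. The two parts of a composition are viewed as subgraphs of the
result that have just the identified terminals in common. -/
inductive IsTwoTerminalSP : Graph α β → α → α → Prop
  | edge (e : β) (s t : α) (hst : s ≠ t) : IsTwoTerminalSP (Graph.banana s t {e}) s t
  | series (G G₁ G₂ : Graph α β) (s m t : α) (h₁ : IsTwoTerminalSP G₁ s m)
      (h₂ : IsTwoTerminalSP G₂ m t) (hG : IsEdgeDisjointUnion G G₁ G₂)
      (hV : G₁.vertexSet ∩ G₂.vertexSet = {m}) : IsTwoTerminalSP G s t
  | parallel (G G₁ G₂ : Graph α β) (s t : α) (h₁ : IsTwoTerminalSP G₁ s t)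
      (h₂ : IsTwoTerminalSP G₂ s t) (hG : IsEdgeDisjointUnion G G₁ G₂)
      (hV : G₁.vertexSet ∩ G₂.vertexSet = {s, t}) : IsTwoTerminalSP G s t

/-- `G` is a series-parallel graph. -/
def IsSeriesParallel (G : Graph α β) : Prop :=
  ∃ s t, IsTwoTerminalSP G s t

/-- The graph `G + (s, t)`: the new edge is labelled `none`, the old edges keep their labels. -/
def addEdge (G : Graph α β) (s t : α) : Graph α (Option β) where
  vertexSet := G.vertexSet ∪ {s, t}
  IsLink e x y := (∃ f, e = some f ∧ G.IsLink f x y) ∨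
    (e = none ∧ ((x = s ∧ y = t) ∨ (x = t ∧ y = s)))
  isLink_symm e _ := ⟨by
    rintro x y (⟨f, hf, h⟩ | ⟨he, h⟩)
    · exact Or.inl ⟨f, hf, h.symm⟩
    · exact Or.inr ⟨he, by tauto⟩⟩
  eq_or_eq_of_isLink_of_isLink := by
    rintro e x y v w (⟨f, rfl, h⟩ | ⟨rfl, h⟩) (⟨f', hf', h'⟩ | ⟨he', h'⟩)
    · cases hf'
      exact h.left_eq_or_eq h'
    · cases he'
    · cases hf'
    · grind
  left_mem_of_isLink := by
    rintro e x y (⟨f, _, h⟩ | ⟨_, ⟨rfl, _⟩ | ⟨rfl, _⟩⟩)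
    · exact Or.inl h.left_mem
    · exact Or.inr (by simp)
    · exact Or.inr (by simp)

/-! ### Neighbourhoods -/

/-- The boundary `∂_G(X)`: the vertices of `X` that have a neighbour outside of `X`. -/
def boundary (G : Graph α β) (X : Set α) : Set α :=
  {v | v ∈ X ∧ ∃ w ∈ G.vertexSet \ X, G.Adj v w}

/-- The degree of a vertex of a loopless graph: its number of incident edges. -/
noncomputable def degree (G : Graph α β) (v : α) : ℕ :=
  (G.incidenceSet v).ncard

/-! ### The disjoint `K₄`-minor cover problem -/

/-- An instance `(G, S, k)`: a finite loopless multigraph `G`, a `K₄`-minor cover `S` of `G` and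
an integer `k`. (Branching and reducing change `k` and `S` independently, so `k` is not tied to
`|S|`.) -/
structure Instance (α β : Type*) where
  G : Graph α β
  S : Set α
  k : ℤ
  finite_vertexSet : G.vertexSet.Finite
  finite_edgeSet : G.edgeSet.Finite
  loopless : G.Loopless
  cover : IsK4MinorCover G S

namespace Instance

variable (I : Instance α β)

/-- `F = V(G) \ S`. -/
def F : Set α := I.G.vertexSet \ I.S

/-- The set `N_S(v)` of the neighbours of `v` in `S`. -/
def NS (v : α) : Set α := {s | s ∈ I.S ∧ I.G.Adj v s}

/-- The induced subgraph `G[S]`. -/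
def GS : Graph α β := I.G.induce I.S

/-! ### Reduction rules

Each of the following propositions says that the rule in question can be applied to `I` so that
it modifies `I`. -/

/-- 1-boundary rule: `X ⊆ F`, and (a) `G[X]` is a component of `G`, or of `G \ e` for a cut edge
`e`, and `X` gets deleted, or (b) `|∂(X)| = 1`, and the nonempty set `X \ ∂(X)` gets deleted. -/
def OneBoundaryRuleApplies : Prop :=
  ∃ X ⊆ I.F,
    (IsComponent I.G X ∨ ∃ e, IsCutEdge I.G e ∧ IsComponent (I.G.deleteEdges {e}) X) ∨
    ((boundary I.G X).ncard = 1 ∧ (X \ boundary I.G X).Nonempty)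

/-- Bypassing rule: a vertex `v ∈ F` of degree two with neighbours `u₁ ∈ V` and `u₂ ∈ F` gets
replaced by an edge `(u₁, u₂)`. -/
def BypassingRuleApplies : Prop :=
  ∃ v ∈ I.F, degree I.G v = 2 ∧
    ∃ u₁ ∈ I.G.vertexSet, ∃ u₂ ∈ I.F, u₁ ≠ u₂ ∧ I.G.Adj v u₁ ∧ I.G.Adj v u₂

/-- Parallel rule: all but one of several edges between `u ∈ V` and `v ∈ F` get deleted. -/
def ParallelRuleApplies : Prop :=
  ∃ u ∈ I.G.vertexSet, ∃ v ∈ I.F, ∃ e f, e ≠ f ∧ I.G.IsLink e u v ∧ I.G.IsLink f u v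

/-- Chandelier rule: `u₁, …, u_ℓ`, with `ℓ ≥ 4`, is a path in `G[F]`, `N_S(u_i) = {x}` for all `i`,
and the inner vertices of the path have degree three in `G`. The edge `(u₂, u₃)` gets
contracted. -/
def ChandelierRuleApplies : Prop :=
  ∃ (l : ℕ) (u : ℕ → α), ∃ x ∈ I.S, 4 ≤ l ∧
    Set.InjOn u (Set.Icc 1 l) ∧
    (∀ i ∈ Set.Icc 1 l, u i ∈ I.F ∧ I.NS (u i) = {x}) ∧
    (∀ i ∈ Set.Ico 1 l, I.G.Adj (u i) (u (i + 1))) ∧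
    (∀ i ∈ Set.Ioo 1 l, degree I.G (u i) = 3)

/-- 2-boundary rule: `X ⊆ F`, `G[X]` is connected, `∂(X) = {s, t}`, and either `G[X] + (s, t)` is
series-parallel and `|X| > 2`, when `X` gets replaced by an edge `(s, t)`, or it is not
series-parallel and `|X| > 4`, when `X` gets replaced by `K₄` minus the edge `(s, t)`. -/
def TwoBoundaryRuleApplies : Prop :=
  ∃ X ⊆ I.F, ∃ s t, s ≠ t ∧ IsConnected (I.G.induce X) ∧ boundary I.G X = {s, t} ∧
    ((IsSeriesParallel (addEdge (I.G.induce X) s t) ∧ 2 < X.ncard) ∨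
      (¬ IsSeriesParallel (addEdge (I.G.induce X) s t) ∧ 4 < X.ncard))

/-- None of the (explicit) reduction rules applies. -/
def IsReduced : Prop :=
  ¬ I.OneBoundaryRuleApplies ∧ ¬ I.BypassingRuleApplies ∧ ¬ I.ParallelRuleApplies ∧
    ¬ I.ChandelierRuleApplies ∧ ¬ I.TwoBoundaryRuleApplies

/-! ### Branching rules, on a set `X ⊆ F`

The first rule branches into the instances `(G - x, S, k - 1)` for `x ∈ X`; the other two have the
further branch `(G, S ∪ X, k)`. -/

/-- `G[S ∪ X]` contains a `K₄`-subdivision. -/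
def BranchingRule1Applies (X : Set α) : Prop :=
  X ⊆ I.F ∧ HasK4Subdivision (I.G.induce (I.S ∪ X))

/-- `G[X]` is connected and has two neighbours in different components of `G[S]`. -/
def BranchingRule2Applies (X : Set α) : Prop :=
  X ⊆ I.F ∧ IsConnected (I.G.induce X) ∧
    ∃ s₁ ∈ I.S, ∃ s₂ ∈ I.S, s₁ ≠ s₂ ∧ (∃ v ∈ X, I.G.Adj v s₁) ∧ (∃ v ∈ X, I.G.Adj v s₂) ∧
      ¬ SameComponent I.GS s₁ s₂

/-- `G[X]` is connected and has two neighbours in the same component of `G[S]` that do not belong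
to a common biconnected component of `G[S]`. -/
def BranchingRule3Applies (X : Set α) : Prop :=
  X ⊆ I.F ∧ IsConnected (I.G.induce X) ∧
    ∃ s₁ ∈ I.S, ∃ s₂ ∈ I.S, s₁ ≠ s₂ ∧ (∃ v ∈ X, I.G.Adj v s₁) ∧ (∃ v ∈ X, I.G.Adj v s₂) ∧
      SameComponent I.GS s₁ s₂ ∧
      ¬ ∃ B, IsBlock I.GS B ∧ s₁ ∈ B.vertexSet ∧ s₂ ∈ B.vertexSet

/-- Independent instances. -/
structure IsIndependent : Prop where
  /-- `F` is an independent set. -/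
  independent : ∀ u ∈ I.F, ∀ v ∈ I.F, ¬ I.G.Adj u v
  /-- Every vertex of `F` has exactly two neighbours in `S`. -/
  two_neighbours : ∀ v ∈ I.F, (I.NS v).ncard = 2
  /-- The two neighbours belong to the same biconnected component of `G[S]`. -/
  same_block : ∀ v ∈ I.F, ∃ B, IsBlock I.GS B ∧ I.NS v ⊆ B.vertexSet
  /-- `G[S ∪ {x}]` is `K₄`-minor-free for every `x ∈ F`. -/
  k4_minor_free : ∀ x ∈ I.F, ¬ HasK4Minor (I.G.induce (I.S ∪ {x}))

end Instance

end K4Cover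

/-!
Let `X` be a component of `G[F]` and let `N ⊆ S` be the set of its neighbours in `S`. As no
branching rule applies to `X`, the graph `G[S ∪ X]` has no `K₄` minor, and any two vertices of `N`
lie in a common block of `G[S]`.

* `N` has at most two elements (`NoBranching.ncard_attachments_le_two`). No vertex separates two
  elements of `N` in `G[S]`, so three of them would be the roots of a triangle minor of `G[S]`
  (`exists_rooted_triangle`), and `X` would complete it to a `K₄` minor.
* If `X` has more than one vertex, each of its vertices has a neighbour in `X`. The 1-boundary,
  bypassing and parallel rules then ensure that all of them have at least three neighbours. Now
  consider the graph induced by `X ∪ N`, with an edge between the two elements of `N` if there are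
  two; it is a minor of `G[S ∪ X]`, since the elements of `N` are joined in `G[S]`. All its
  vertices except for the ends of at most one edge have degree at least three, so it has a `K₄`
  minor by `hasK4Model_of_three_le_ncard_nbrs`, a contradiction.

So `X` is a single vertex (`IsReduced.reachSet_F_eq_singleton`). It has at least two neighbours by
the 1-boundary and parallel rules, all of them in `N`, and the remaining claims follow.

The degree lemma is proved by induction on the number of vertices. A contraction of an edge
preserves its hypotheses unless the edge is in a triangle with a vertex of degree three. If this
holds for all edges, there are two adjacent vertices of degree three with the same two further
neighbours `a`, `b`; either `a` and `b` are joined by a path that avoids the two, which gives a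
`K₄` minor, or the graph splits into smaller ones (`hasK4Model_of_diamond`).

Minors are represented by branch sets in the simple graph `toSimple G` (`HasK4Model`); they yield
subdivisions by `hasK4Subdivision_of_hasK4Model`, as `K₄` is cubic.
-/

namespace K4Cover

variable {α β : Type*}

/-! ### Connected vertex sets -/

section Connectivity

variable {H : SimpleGraph α} {s Y : Set α}

lemma mem_of_reachable {T : Set α} {x y : α} (h : H.Reachable x y) (hx : x ∈ T)
    (hT : ∀ a ∈ T, ∀ b, H.Adj a b → b ∈ T) : y ∈ T := by
  rw [SimpleGraph.reachable_iff_reflTransGen] at h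
  induction h with
  | refl => exact hx
  | tail _ h ih => exact hT _ ih _ h

/-- The vertices reachable from `a` inside `Y`. -/
def reachSet (H : SimpleGraph α) (Y : Set α) (a : α) : Set α :=
  {z | ∃ (ha : a ∈ Y) (hz : z ∈ Y), (H.induce Y).Reachable ⟨a, ha⟩ ⟨z, hz⟩}

lemma reachSet_subset {a : α} : reachSet H Y a ⊆ Y := fun _ h => h.2.1

lemma self_mem_reachSet {a : α} (ha : a ∈ Y) : a ∈ reachSet H Y a :=
  ⟨ha, ha, SimpleGraph.Reachable.refl _⟩

lemma mem_reachSet_of_adj {a p q : α} (hp : p ∈ reachSet H Y a) (hq : q ∈ Y) (h : H.Adj p q) :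
    q ∈ reachSet H Y a := by
  obtain ⟨ha, hp', hr⟩ := hp
  exact ⟨ha, hq, hr.trans (SimpleGraph.Adj.reachable (by simpa using h))⟩

lemma reachSet_subset_of_closed {a : α} {T : Set α} (ha : a ∈ T)
    (hT : ∀ p ∈ T, ∀ q ∈ Y, H.Adj p q → q ∈ T) : reachSet H Y a ⊆ T := by
  rintro z ⟨haY, hz, hr⟩
  exact mem_of_reachable (T := {v : Y | v.1 ∈ T}) hr ha
    fun p hp q hpq => hT _ hp _ q.2 (by simpa using hpq)

/-- A set is connected if and only if it has no proper nonempty subset that is closed under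
adjacency. -/
lemma connected_induce_iff : (H.induce s).Connected ↔
    s.Nonempty ∧ ∀ T ⊆ s, T.Nonempty → (∀ p ∈ T, ∀ q ∈ s, H.Adj p q → q ∈ T) → s ⊆ T := by
  constructor
  · intro h
    have hne := h.nonempty
    refine ⟨Set.nonempty_coe_sort.1 hne, fun T hTs ⟨a, ha⟩ hT b hb => ?_⟩
    exact reachSet_subset_of_closed ha hT ⟨hTs ha, hb, h.preconnected _ _⟩
  · rintro ⟨⟨x, hx⟩, h⟩
    rw [SimpleGraph.connected_iff_exists_forall_reachable]
    refine ⟨⟨x, hx⟩, fun w => ?_⟩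
    exact (h (reachSet H s x) reachSet_subset ⟨x, self_mem_reachSet hx⟩
      (fun p hp q hq hpq => mem_reachSet_of_adj hp hq hpq) w.2).2.2

lemma connected_reachSet {a : α} (ha : a ∈ Y) : (H.induce (reachSet H Y a)).Connected := by
  rw [connected_induce_iff]
  refine ⟨⟨a, self_mem_reachSet ha⟩, fun T hTs ⟨b, hb⟩ hT => ?_⟩
  have haT : a ∈ T := by
    by_contra haT
    refine (reachSet_subset_of_closed (T := reachSet H Y a \ T)
      ⟨self_mem_reachSet ha, haT⟩ ?_ (hTs hb)).2 hb
    rintro p ⟨hp, hpT⟩ q hq hpq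
    exact ⟨mem_reachSet_of_adj hp hq hpq, fun hqT => hpT (hT q hqT p hp hpq.symm)⟩
  exact reachSet_subset_of_closed haT
    fun p hp q hq hpq => hT p hp q (mem_reachSet_of_adj (hTs hp) hq hpq) hpq

lemma connected_subset_reachSet {a : α} (hs : (H.induce s).Connected) (hsY : s ⊆ Y) (ha : a ∈ s) :
    s ⊆ reachSet H Y a := by
  have := (connected_induce_iff.1 hs).2 (reachSet H Y a ∩ s) Set.inter_subset_right
    ⟨a, self_mem_reachSet (hsY ha), ha⟩
    fun p hp q hq hpq => ⟨mem_reachSet_of_adj hp.1 (hsY hq) hpq, hq⟩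
  exact fun x hx => (this hx).1

lemma connected_induce_singleton (a : α) : (H.induce {a}).Connected := by
  rw [connected_induce_iff]
  refine ⟨⟨a, rfl⟩, ?_⟩
  rintro T hT ⟨b, hb⟩ - _ rfl
  rwa [← Set.mem_singleton_iff.1 (hT hb)]

lemma connected_insert {a b : α} (hs : (H.induce s).Connected) (ha : a ∈ s) (hab : H.Adj a b) :
    (H.induce (insert b s)).Connected := by
  rw [connected_induce_iff] at hs ⊢
  refine ⟨⟨b, by simp⟩, fun T hTs hTn hT => ?_⟩
  have hne : (T ∩ s).Nonempty := by
    obtain ⟨c, hc⟩ := hTn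
    rcases hTs hc with rfl | hcs
    · exact ⟨a, hT c hc a (by simp [ha]) hab.symm, ha⟩
    · exact ⟨c, hc, hcs⟩
  have hsub := hs.2 (T ∩ s) Set.inter_subset_right hne
    fun p hp q hq hpq => ⟨hT p hp.1 q (by simp [hq]) hpq, hq⟩
  rintro c (rfl | hc)
  · exact hT a (hsub ha).1 c (by simp) hab
  · exact (hsub hc).1

/-- A vertex `b` of the component of `a` other than `a` has a neighbour in the component of `a`
after the deletion of `b`. -/
lemma exists_adj_reachSet_diff {a b : α} (hab : a ≠ b) (hb : b ∈ reachSet H Y a) :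
    ∃ p ∈ reachSet H (Y \ {b}) a, H.Adj p b := by
  by_contra! hcon
  have ha : a ∈ Y := hb.1
  have : b ∈ reachSet H (Y \ {b}) a := by
    refine reachSet_subset_of_closed (T := reachSet H (Y \ {b}) a)
      (self_mem_reachSet ⟨ha, hab⟩) ?_ hb
    intro p hp q hq hpq
    refine mem_reachSet_of_adj hp ⟨hq, ?_⟩ hpq
    rintro rfl
    exact hcon p hp hpq
  exact (reachSet_subset this).2 rfl

end Connectivity

/-! ### Models of `K₄` -/

section Models

variable {H H' : SimpleGraph α} {W W' : Set α}

/-- `K₄` is a minor of the subgraph of `H` induced by `W`: there are four disjoint connected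
subsets of `W` that are pairwise joined by edges. -/
def HasK4Model (H : SimpleGraph α) (W : Set α) : Prop :=
  ∃ B : Fin 4 → Set α, (∀ i, B i ⊆ W ∧ (H.induce (B i)).Connected) ∧
    (∀ i j, i ≠ j → Disjoint (B i) (B j)) ∧
    ∀ i j, i ≠ j → ∃ x ∈ B i, ∃ y ∈ B j, H.Adj x y

lemma HasK4Model.mono (hW : W ⊆ W') (h : HasK4Model H W) : HasK4Model H W' := by
  obtain ⟨B, hB, h⟩ := h
  exact ⟨B, fun i => ⟨(hB i).1.trans hW, (hB i).2⟩, h⟩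

lemma hasK4Model_of_sets {A B C D : Set α}
    (hA : (H.induce A).Connected) (hB : (H.induce B).Connected) (hC : (H.induce C).Connected)
    (hD : (H.induce D).Connected) (hAW : A ⊆ W) (hBW : B ⊆ W) (hCW : C ⊆ W) (hDW : D ⊆ W)
    (dAB : Disjoint A B) (dAC : Disjoint A C) (dAD : Disjoint A D)
    (dBC : Disjoint B C) (dBD : Disjoint B D) (dCD : Disjoint C D)
    (eAB : ∃ x ∈ A, ∃ y ∈ B, H.Adj x y) (eAC : ∃ x ∈ A, ∃ y ∈ C, H.Adj x y)
    (eAD : ∃ x ∈ A, ∃ y ∈ D, H.Adj x y) (eBC : ∃ x ∈ B, ∃ y ∈ C, H.Adj x y)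
    (eBD : ∃ x ∈ B, ∃ y ∈ D, H.Adj x y) (eCD : ∃ x ∈ C, ∃ y ∈ D, H.Adj x y) :
    HasK4Model H W := by
  have sw : ∀ {P Q : Set α}, (∃ x ∈ P, ∃ y ∈ Q, H.Adj x y) → ∃ x ∈ Q, ∃ y ∈ P, H.Adj x y :=
    fun ⟨x, hx, y, hy, h⟩ => ⟨y, hy, x, hx, h.symm⟩
  refine ⟨![A, B, C, D], ?_, ?_, ?_⟩
  · simp only [Fin.forall_fin_succ]
    simp [*]
  · intro i j hij
    fin_cases i <;> fin_cases j <;> first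
      | exact absurd rfl hij
      | simpa using by assumption
      | (rw [disjoint_comm]; simpa using by assumption)
  · intro i j hij
    fin_cases i <;> fin_cases j <;> first
      | exact absurd rfl hij
      | assumption
      | (apply sw; assumption)

/-- A model of `K₄` in a minor lifts: the vertex `a` of the minor stands for the branch set
`φ a`. -/
lemma HasK4Model.lift (φ : α → Set α) (hφ : ∀ a ∈ W', φ a ⊆ W ∧ (H.induce (φ a)).Connected)
    (hdisj : ∀ a ∈ W', ∀ b ∈ W', a ≠ b → Disjoint (φ a) (φ b))
    (hadj : ∀ a ∈ W', ∀ b ∈ W', H'.Adj a b → ∃ p ∈ φ a, ∃ q ∈ φ b, H.Adj p q)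
    (h : HasK4Model H' W') : HasK4Model H W := by
  obtain ⟨B, hB, hd, ha⟩ := h
  refine ⟨fun i => ⋃ a ∈ B i, φ a, fun i => ⟨?_, ?_⟩, ?_, ?_⟩
  · simp only [Set.iUnion_subset_iff]
    exact fun a ha => (hφ a ((hB i).1 ha)).1
  · have hBi := connected_induce_iff.1 (hB i).2
    have hfib := fun a (ha : a ∈ B i) => connected_induce_iff.1 (hφ a ((hB i).1 ha)).2
    rw [connected_induce_iff]
    constructor
    · obtain ⟨a, ha⟩ := hBi.1
      obtain ⟨p, hp⟩ := (hfib a ha).1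
      exact ⟨p, Set.mem_biUnion ha hp⟩
    · rintro T hT ⟨p, hp⟩ hcl
      have key : ∀ a ∈ B i, ∀ p ∈ φ a, p ∈ T → φ a ⊆ T := by
        intro a ha p hpa hpT
        have := (hfib a ha).2 (T ∩ φ a) Set.inter_subset_right ⟨p, hpT, hpa⟩
          fun x hx y hy hxy => ⟨hcl x hx.1 y (Set.mem_biUnion ha hy) hxy, hy⟩
        exact fun x hx => (this hx).1
      obtain ⟨a, ha, hpa⟩ := Set.mem_iUnion₂.1 (hT hp)
      have := hBi.2 {a | a ∈ B i ∧ φ a ⊆ T} (fun _ h => h.1) ⟨a, ha, key a ha p hpa hp⟩ ?_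
      · exact Set.iUnion₂_subset fun b hb => (this hb).2
      · rintro c ⟨hc, hcT⟩ d hd hcd
        obtain ⟨x, hx, y, hy, hxy⟩ := hadj c ((hB i).1 hc) d ((hB i).1 hd) hcd
        exact ⟨hd, key d hd y hy (hcl x (hcT hx) y (Set.mem_biUnion hd hy) hxy)⟩
  · intro i j hij
    simp only [Set.disjoint_iUnion_left, Set.disjoint_iUnion_right]
    intro a ha b hb
    refine hdisj _ ((hB _).1 (by assumption)) _ ((hB _).1 (by assumption)) ?_
    rintro rfl
    exact Set.disjoint_left.1 (hd i j hij) (by assumption) (by assumption)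
  · intro i j hij
    obtain ⟨a, ha, b, hb, hab⟩ := ha i j hij
    obtain ⟨x, hx, y, hy, hxy⟩ := hadj a ((hB i).1 ha) b ((hB j).1 hb) hab
    exact ⟨x, Set.mem_biUnion ha hx, y, Set.mem_biUnion hb hy, hxy⟩

end Models

/-! ### From minors to subdivisions -/

section Subdivision

variable {H : SimpleGraph α}

/-- A walk that ends in `D` has an initial part that meets `D` in its last vertex only. -/
lemma exists_walk_first_mem {D : Set α} {u v : α} (p : H.Walk u v) (hv : v ∈ D) :
    ∃ m ∈ D, ∃ q : H.Walk u m, (∀ x ∈ q.support, x ∈ p.support) ∧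
      ∀ x ∈ q.support, x ∈ D → x = m := by
  induction p with
  | nil => exact ⟨_, hv, .nil, by simp, by simp⟩
  | @cons u u' v h p ih =>
    by_cases hu : u ∈ D
    · exact ⟨u, hu, .nil, by simp, by simp⟩
    · obtain ⟨m, hm, q, hq, hqD⟩ := ih hv
      refine ⟨m, hm, .cons h q, ?_, ?_⟩
      · simp only [SimpleGraph.Walk.support_cons, List.mem_cons]
        grind
      · simp only [SimpleGraph.Walk.support_cons, List.mem_cons]
        grind

/-- A vertex `m` of a path splits it into two walks from `m` that have just `m` in common. -/
lemma exists_split_of_isPath {a b m : α} (p : H.Walk a b) (hp : p.IsPath) (hm : m ∈ p.support) :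
    ∃ (q : H.Walk m a) (r : H.Walk m b), (∀ x ∈ q.support, x ∈ p.support) ∧
      (∀ x ∈ r.support, x ∈ p.support) ∧ ∀ x ∈ q.support, x ∈ r.support → x = m := by
  induction p with
  | nil =>
    obtain rfl : m = _ := by simpa using hm
    exact ⟨.nil, .nil, by simp, by simp, by simp⟩
  | @cons a a' b h p ih =>
    rw [SimpleGraph.Walk.cons_isPath_iff] at hp
    by_cases hma : m = a
    · subst hma
      exact ⟨.nil, .cons h p, by simp, by simp, by simp⟩
    · obtain ⟨q, r, hq, hr, hqr⟩ := ih hp.1 (by simpa [hma] using hm)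
      refine ⟨q.concat h.symm, r, ?_, ?_, ?_⟩
      · simp only [SimpleGraph.Walk.support_concat, SimpleGraph.Walk.support_cons]
        grind
      · simp only [SimpleGraph.Walk.support_cons]
        grind
      · simp only [SimpleGraph.Walk.support_concat]
        grind

/-- Three vertices of a connected set are joined to some vertex `c` of it by walks that meet in `c`
only. -/
lemma exists_tripod {s : Set α} (hs : (H.induce s).Connected) (t : Fin 3 → α) (ht : ∀ k, t k ∈ s) :
    ∃ c ∈ s, ∃ P : Fin 3 → Set α, (∀ k, P k ⊆ s) ∧
      (∀ k, ∃ p : H.Walk c (t k), ∀ x ∈ p.support, x ∈ P k) ∧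
      ∀ k l, k ≠ l → ∀ x ∈ P k, x ∈ P l → x = c := by
  classical
  have hw : ∀ x ∈ s, ∀ y ∈ s, ∃ p : H.Walk x y, ∀ z ∈ p.support, z ∈ s := by
    intro x hx y hy
    have key : ∀ (x y : s) (_ : (H.induce s).Walk x y),
        ∃ p : H.Walk x.1 y.1, ∀ z ∈ p.support, z ∈ s := by
      intro x y p
      induction p with
      | @nil u => exact ⟨.nil, by simp⟩
      | @cons u v w h p ih =>
        obtain ⟨q, hq⟩ := ih
        have h' : H.Adj u.1 v.1 := by simpa using h
        refine ⟨.cons h' q, ?_⟩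
        simpa using hq
    obtain ⟨p⟩ := hs.preconnected ⟨x, hx⟩ ⟨y, hy⟩
    exact key _ _ p
  obtain ⟨p, hp⟩ := hw _ (ht 0) _ (ht 1)
  obtain ⟨q, hq⟩ := hw _ (ht 2) _ (ht 0)
  have hpb := SimpleGraph.Walk.support_bypass_subset_support p
  obtain ⟨m, hm, r, hrq, hr⟩ :=
    exists_walk_first_mem (D := {x | x ∈ p.bypass.support}) q (by simp)
  obtain ⟨u, v, hu, hv, huv⟩ := exists_split_of_isPath p.bypass (p.bypass_isPath) hm
  refine ⟨m, hp _ (hpb hm), ![{x | x ∈ u.support}, {x | x ∈ v.support}, {x | x ∈ r.support}],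
    ?_, ?_, ?_⟩
  · intro k
    fin_cases k
    · exact fun x hx => hp _ (hpb (hu x hx))
    · exact fun x hx => hp _ (hpb (hv x hx))
    · exact fun x hx => hq _ (hrq x hx)
  · intro k
    fin_cases k
    · exact ⟨u, fun x hx => hx⟩
    · exact ⟨v, fun x hx => hx⟩
    · exact ⟨r.reverse, fun x hx => by simpa using hx⟩
  · intro k l hkl x hk hl
    fin_cases k <;> fin_cases l <;> simp at hkl hk hl
    · exact huv x hk hl
    · exact hr x hl (hu x hk)
    · exact huv x hl hk
    · exact hr x hl (hv x hk)
    · exact hr x hk (hu x hl)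
    · exact hr x hk (hv x hl)

/-- As `K₄` is cubic, a `K₄` minor yields a subdivision: join the ends of the three edges that
leave a branch set by a tripod inside that branch set. -/
lemma hasK4Subdivision_of_hasK4Model {G : Graph α β} {W : Set α} (h : HasK4Model (toSimple G) W) :
    HasK4Subdivision G := by
  classical
  obtain ⟨B, hB, hd, hadj⟩ := h
  have : Nonempty α := ⟨(hadj 0 1 (by decide)).choose⟩
  choose! e he f hf hef using hadj
  -- `a i j` is the end in `B i` of a chosen edge between `B i` and `B j`
  let a : Fin 4 → Fin 4 → α := fun i j => if i < j then e i j else f j i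
  have ha : ∀ i j, i ≠ j → a i j ∈ B i := by
    intro i j hij
    by_cases h : i < j
    · simpa [a, h] using he i j hij
    · simpa [a, h] using hf j i hij.symm
  have hadj : ∀ i j, i < j → (toSimple G).Adj (a i j) (a j i) := by
    intro i j hij
    simpa [a, hij, hij.not_gt] using hef i j hij.ne
  have htri : ∀ i, ∃ c ∈ B i, ∃ P : Fin 4 → Set α, (∀ j, j ≠ i → P j ⊆ B i) ∧
      (∀ j, j ≠ i → ∃ p : (toSimple G).Walk c (a i j), ∀ x ∈ p.support, x ∈ P j) ∧
      ∀ j l, j ≠ i → l ≠ i → j ≠ l → ∀ x ∈ P j, x ∈ P l → x = c := by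
    intro i
    obtain ⟨c, hc, P, hP, hp, hPP⟩ := exists_tripod (hB i).2 (fun k => a i (i.succAbove k))
      (fun k => ha i _ (Fin.succAbove_ne i k).symm)
    have hk : ∀ j, ∃ k, j ≠ i → i.succAbove k = j := by
      intro j
      by_cases hj : j = i
      · exact ⟨0, fun h => absurd hj h⟩
      · obtain ⟨k, hk⟩ := Fin.exists_succAbove_eq hj
        exact ⟨k, fun _ => hk⟩
    choose k hk using hk
    refine ⟨c, hc, fun j => P (k j), fun j _ => hP _, fun j hj => ?_, ?_⟩
    · have := hp (k j)
      rwa [hk j hj] at this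
    · intro j l hj hl hjl x hx hx'
      refine hPP (k j) (k l) (fun h => hjl ?_) x hx hx'
      rw [← hk j hj, ← hk l hl, h]
  choose c hc P hPB hp hPP using htri
  have hw : ∀ i j, i < j → ∃ p : (toSimple G).Walk (c i) (c j), p.IsPath ∧
      ∀ x ∈ p.support, x ∈ P i j ∨ x ∈ P j i := by
    intro i j hij
    obtain ⟨p, hpP⟩ := hp i j hij.ne'
    obtain ⟨q, hqP⟩ := hp j i hij.ne
    refine ⟨(p.append (.cons (hadj i j hij) q.reverse)).bypass,
      SimpleGraph.Walk.bypass_isPath _, fun x hx => ?_⟩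
    have hx' := SimpleGraph.Walk.support_bypass_subset_support _ hx
    rw [SimpleGraph.Walk.mem_support_append_iff, SimpleGraph.Walk.support_cons, List.mem_cons,
      SimpleGraph.Walk.support_reverse, List.mem_reverse] at hx'
    rcases hx' with h | rfl | h
    · exact Or.inl (hpP x h)
    · exact Or.inl (hpP _ p.end_mem_support)
    · exact Or.inr (hqP x h)
  choose p hpath hsupp using hw
  have hBd : ∀ i j x, x ∈ B i → x ∈ B j → i = j := by
    intro i j x hi hj
    by_contra hij
    exact Set.disjoint_left.1 (hd i j hij) hi hj
  refine ⟨c, p, ?_, hpath, ?_, ?_⟩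
  · intro i j hij
    exact hBd i j (c i) (hc i) (hij ▸ hc j)
  · intro i j hij m hm
    rcases hsupp i j hij _ hm with h | h
    · exact Or.inl (hBd _ _ _ (hc m) (hPB i j hij.ne' h))
    · exact Or.inr (hBd _ _ _ (hc m) (hPB j i hij.ne h))
  · intro i j hij k l hkl hne x hx hx'
    have key : ∀ i j k l, j ≠ i → l ≠ k → ¬(i = k ∧ j = l) → x ∈ P i j → x ∈ P k l →
        ∃ m, x = c m := by
      intro i j k l hji hlk hne h h'
      obtain rfl := hBd i k x (hPB i j hji h) (hPB k l hlk h')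
      exact ⟨i, hPP i j l hji hlk (fun h => hne ⟨rfl, h⟩) x h h'⟩
    have hne' : ¬(i = k ∧ j = l) := fun h => hne (by rw [h.1, h.2])
    rcases hsupp i j hij x hx with h | h <;> rcases hsupp k l hkl x hx' with h' | h'
    · exact key i j k l hij.ne' hkl.ne' hne' h h'
    · exact key i j l k hij.ne' hkl.ne (fun ⟨h₁, h₂⟩ => by omega) h h'
    · exact key j i k l hij.ne hkl.ne' (fun ⟨h₁, h₂⟩ => by omega) h h'
    · exact key j i l k hij.ne hkl.ne (fun ⟨h₁, h₂⟩ => hne' ⟨h₂, h₁⟩) h h'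

end Subdivision

/-! ### Rooted triangles -/

section RootedTriangle

variable {H : SimpleGraph α} {S : Set α}

/-- If no single vertex separates two of the vertices `a`, `b`, `c`, then there is a triangle minor
whose branch sets contain `a`, `b` and `c`, respectively. The branch set of `c` is a maximal
connected set whose deletion does not separate `a` from `b`. By maximality, each of its neighbours
other than `a` and `b` separates `a` from `b` in what is left, and there are at least two
neighbours, as a single one would separate `c` from `a` or `b`. -/
lemma exists_rooted_triangle (hS : S.Finite) {a b c : α} (hac : a ≠ c)
    (sab : ∀ u, u ≠ a → u ≠ b → b ∈ reachSet H (S \ {u}) a)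
    (sac : ∀ u, u ≠ a → u ≠ c → a ∈ reachSet H (S \ {u}) c)
    (sbc : ∀ u, u ≠ b → u ≠ c → b ∈ reachSet H (S \ {u}) c) (hab : a ≠ b) (hbc : b ≠ c) :
    ∃ A B C : Set α, (A ⊆ S ∧ (H.induce A).Connected ∧ a ∈ A) ∧
      (B ⊆ S ∧ (H.induce B).Connected ∧ b ∈ B) ∧ (C ⊆ S ∧ (H.induce C).Connected ∧ c ∈ C) ∧
      Disjoint A B ∧ Disjoint A C ∧ Disjoint B C ∧ (∃ x ∈ A, ∃ y ∈ B, H.Adj x y) ∧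
      (∃ x ∈ A, ∃ y ∈ C, H.Adj x y) ∧ ∃ x ∈ B, ∃ y ∈ C, H.Adj x y := by
  have hcS : c ∈ S := (sac b hab.symm hbc).1.1
  obtain ⟨C, ⟨hCS, hC, hcC, haC, hbM⟩, hmax⟩ := Set.Finite.exists_maximal
    (s := {C | C ⊆ S ∧ (H.induce C).Connected ∧ c ∈ C ∧ a ∉ C ∧ b ∈ reachSet H (S \ C) a})
    (hS.finite_subsets.subset fun C hC => hC.1)
    ⟨{c}, by simpa using hcS, connected_induce_singleton c, rfl, hac, sab c hac.symm hbc.symm⟩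
  have haS : a ∈ S := hbM.1.1
  have hbC : b ∉ C := (reachSet_subset hbM).2
  -- the component of `a` after the deletion of `C` and of a neighbour of `C` misses `b`
  have hsep : ∀ u ∈ S \ C, u ≠ a → (∃ p ∈ C, H.Adj p u) →
      b ∉ reachSet H (S \ insert u C) a := by
    rintro u ⟨huS, huC⟩ hua ⟨p, hp, hpu⟩ hb
    refine huC (hmax (y := insert u C) ⟨Set.insert_subset huS hCS, connected_insert hC hp hpu,
      Set.mem_insert_of_mem _ hcC, ?_, hb⟩ (Set.subset_insert u C) (Set.mem_insert u C))
    simpa [haC] using hua.symm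
  have hnbr : ∀ w, w ∉ C → ∃ u ∈ S \ C, u ≠ w ∧ ∃ p ∈ C, H.Adj p u := by
    intro w hw
    have hwc : w ≠ c := fun h => hw (h ▸ hcC)
    by_contra! hcon
    have : reachSet H (S \ {w}) c ⊆ C := by
      refine reachSet_subset_of_closed hcC fun p hp q hq hpq => ?_
      by_contra hqC
      exact hcon q ⟨hq.1, hqC⟩ hq.2 p hp hpq
    by_cases hwa : w = a
    · exact hbC (this (sbc w (by rw [hwa]; exact hab) hwc))
    · exact haC (this (sac w hwa hwc))
  have hself : ∀ w, w ≠ a → a ∈ reachSet H (S \ insert w C) a := fun w hw =>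
    self_mem_reachSet ⟨haS, by simpa [haC] using hw.symm⟩
  -- that component reaches the deleted neighbour of `C`
  have hreach : ∀ w ∈ S \ C, w ≠ a → b ∉ reachSet H (S \ insert w C) a →
      ∃ p ∈ reachSet H (S \ insert w C) a, H.Adj p w := by
    intro w hw hwa hb
    by_contra! hcon
    refine hb (reachSet_subset_of_closed (hself w hwa) ?_ hbM)
    intro p hp q hq hpq
    refine mem_reachSet_of_adj hp ⟨hq.1, ?_⟩ hpq
    rintro (rfl | hqC)
    · exact hcon p hp hpq
    · exact hq.2 hqC
  obtain ⟨w, hw, hwa, hwC, w', hw', hw'C, hw'A⟩ : ∃ w ∈ S \ C, w ≠ a ∧ (∃ p ∈ C, H.Adj p w) ∧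
      ∃ w' ∈ S \ C, (∃ p ∈ C, H.Adj p w') ∧ w' ∈ reachSet H (S \ insert w C) a := by
    obtain ⟨u, hu, hua, huC⟩ := hnbr a haC
    obtain ⟨u', hu', huu', hu'C⟩ := hnbr u hu.2
    by_cases h : u' ∈ reachSet H (S \ insert u C) a
    · exact ⟨u, hu, hua, huC, u', hu', hu'C, h⟩
    · have hu'a : u' ≠ a := by
        rintro rfl
        exact h (hself u hua)
      obtain ⟨p, hp, hpu⟩ := hreach u hu hua (hsep u hu hua huC)
      refine ⟨u', hu', hu'a, hu'C, u, hu, huC, ?_⟩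
      have hpA := connected_subset_reachSet (connected_reachSet (reachSet_subset (hself u hua)))
        (Y := S \ insert u' C) ?_ (hself u hua) hp
      · exact mem_reachSet_of_adj hpA ⟨hu.1, by simpa [hu.2] using huu'.symm⟩ hpu
      · intro z hz
        have hz' := reachSet_subset hz
        refine ⟨hz'.1, ?_⟩
        rintro (rfl | hzC)
        · exact h hz
        · exact hz'.2 (Set.mem_insert_of_mem _ hzC)
  have hbA := hsep w hw hwa hwC
  obtain ⟨p, hp, hpw⟩ := hreach w hw hwa hbA
  set A := reachSet H (S \ insert w C) a with hAdef
  have hAS : A ⊆ S \ insert w C := reachSet_subset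
  have hwA : w ∉ A := fun h => (hAS h).2 (Set.mem_insert _ _)
  have hwB : w ∈ (S \ C) \ A := ⟨hw, hwA⟩
  have hBS : reachSet H ((S \ C) \ A) w ⊆ (S \ C) \ A := reachSet_subset
  have hbB : b ∈ reachSet H ((S \ C) \ A) w := by
    have : b ∈ A ∪ reachSet H ((S \ C) \ A) w := by
      refine reachSet_subset_of_closed (T := A ∪ reachSet H ((S \ C) \ A) w)
        (Or.inl (hself w hwa)) ?_ hbM
      rintro p (hp | hp) q hq hpq
      · by_cases hqw : q = w
        · exact Or.inr (by rw [hqw]; exact self_mem_reachSet hwB)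
        · refine Or.inl (mem_reachSet_of_adj hp ⟨hq.1, ?_⟩ hpq)
          simpa [hqw] using hq.2
      · by_cases hqA : q ∈ A
        · exact Or.inl hqA
        · exact Or.inr (mem_reachSet_of_adj hp ⟨hq, hqA⟩ hpq)
    exact this.resolve_left hbA
  obtain ⟨z, hz, hzw⟩ := hwC
  obtain ⟨z', hz', hzw'⟩ := hw'C
  refine ⟨A, reachSet H ((S \ C) \ A) w, C,
    ⟨fun x hx => (hAS hx).1, connected_reachSet (hAS (hself w hwa)), hself w hwa⟩,
    ⟨fun x hx => (hBS hx).1.1, connected_reachSet hwB, hbB⟩, ⟨hCS, hC, hcC⟩,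
    Set.disjoint_left.2 fun x hx hx' => (hBS hx').2 hx,
    Set.disjoint_left.2 fun x hx hx' => (hAS hx).2 (Set.mem_insert_of_mem _ hx'),
    Set.disjoint_left.2 fun x hx hx' => (hBS hx).1.2 hx',
    ⟨p, hp, w, self_mem_reachSet hwB, hpw⟩, ⟨w', hw'A, z', hz', hzw'.symm⟩,
    ⟨w, self_mem_reachSet hwB, z, hz, hzw.symm⟩⟩

end RootedTriangle

/-! ### Graphs of minimum degree three -/

section MinDegree

variable {H : SimpleGraph α} {W : Set α}

/-- The neighbours of `v` in `W`. -/
def nbrs (H : SimpleGraph α) (W : Set α) (v : α) : Set α := {z | H.Adj v z ∧ z ∈ W}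

lemma finite_nbrs (hW : W.Finite) (v : α) : (nbrs H W v).Finite := hW.subset fun _ h => h.2

lemma ncard_pair_le (a b : α) : ({a, b} : Set α).ncard ≤ 2 :=
  (Set.ncard_insert_le _ _).trans (by simp)

/-- The simple graph that arises by the contraction of an edge `uv` to the vertex `u`. The vertex
`v` is kept, but is meant to be ignored. -/
def contract (H : SimpleGraph α) (u v : α) : SimpleGraph α :=
  H ⊔ SimpleGraph.fromRel fun a b => a = u ∧ H.Adj v b

lemma contract_adj {u v a b : α} : (contract H u v).Adj a b ↔
    H.Adj a b ∨ (a ≠ b ∧ ((a = u ∧ H.Adj v b) ∨ (b = u ∧ H.Adj v a))) := by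
  simp [contract]

lemma HasK4Model.of_contract {u v : α} (hu : u ∈ W) (hv : v ∈ W) (huv : H.Adj u v)
    (h : HasK4Model (contract H u v) (W \ {v})) : HasK4Model H W := by
  obtain ⟨φ, hφu, hφ⟩ : ∃ φ : α → Set α, φ u = {v, u} ∧ ∀ a, a ≠ u → φ a = {a} := by
    classical
    exact ⟨fun a => if a = u then {v, u} else {a}, if_pos rfl, fun a ha => if_neg ha⟩
  have mem : ∀ a, a ∈ φ a := by
    intro a
    by_cases ha : a = u
    · simp [ha, hφu]
    · simp [hφ a ha]
  have sub : ∀ a z, z ∈ φ a → z = a ∨ (z = v ∧ a = u) := by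
    intro a z hz
    by_cases ha : a = u
    · rw [ha, hφu] at hz
      simpa [ha, or_comm] using hz
    · rw [hφ a ha] at hz
      exact Or.inl hz
  refine h.lift φ ?_ ?_ ?_
  · rintro a ⟨ha, -⟩
    by_cases hau : a = u
    · rw [hau, hφu]
      exact ⟨by simp [Set.insert_subset_iff, hu, hv],
        connected_insert (connected_induce_singleton u) rfl huv⟩
    · rw [hφ a hau]
      exact ⟨by simpa using ha, connected_induce_singleton a⟩
  · rintro a ⟨ha, hav⟩ b ⟨hb, hbv⟩ hab
    simp only [Set.mem_singleton_iff] at hav hbv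
    rw [Set.disjoint_left]
    intro z hz hz'
    have h₁ := sub a z hz
    have h₂ := sub b z hz'
    grind
  · rintro a ⟨ha, hav⟩ b ⟨hb, hbv⟩ hab
    rcases contract_adj.1 hab with h₁ | ⟨-, ⟨rfl, h₁⟩ | ⟨rfl, h₁⟩⟩
    · exact ⟨a, mem a, b, mem b, h₁⟩
    · exact ⟨v, by simp [hφu], b, mem b, h₁⟩
    · exact ⟨a, mem a, v, by simp [hφu], h₁.symm⟩

/-- A contraction brings the degree of a vertex outside the edge below three only if it closes a
triangle at a vertex of degree three. -/
lemma nbrs_eq_of_ncard_contract_lt (hW : W.Finite) {u v a : α} (hu : u ∈ W)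
    (huv : u ≠ v) (hau : a ≠ u) (h3 : 3 ≤ (nbrs H W a).ncard)
    (hlt : (nbrs (contract H u v) (W \ {v}) a).ncard < 3) :
    ∃ t, t ≠ u ∧ t ≠ v ∧ nbrs H W a = {u, v, t} := by
  have hfin := finite_nbrs (H := H) hW a
  have hfin' := finite_nbrs (H := contract H u v) (hW.sdiff (t := {v})) a
  have hsub : nbrs H W a \ {v} ⊆ nbrs (contract H u v) (W \ {v}) a :=
    fun z ⟨⟨h, hz⟩, hzv⟩ => ⟨contract_adj.2 (Or.inl h), hz, hzv⟩
  have hle := Set.ncard_le_ncard hsub hfin'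
  have hav : v ∈ nbrs H W a := by
    by_contra hav
    rw [Set.sdiff_singleton_eq_self hav] at hle
    omega
  have hvcard := Set.ncard_sdiff_singleton_add_one hav hfin
  have hau' : u ∈ nbrs H W a := by
    by_contra hau'
    have hsub' : insert u (nbrs H W a \ {v}) ⊆ nbrs (contract H u v) (W \ {v}) a :=
      Set.insert_subset ⟨contract_adj.2 (Or.inr ⟨hau, Or.inr ⟨rfl, hav.1.symm⟩⟩), hu, huv⟩ hsub
    have := Set.ncard_le_ncard hsub' hfin'
    rw [Set.ncard_insert_of_notMem (fun h => hau' h.1) hfin.sdiff] at this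
    omega
  have hu' : u ∈ nbrs H W a \ {v} := ⟨hau', huv⟩
  have hucard := Set.ncard_sdiff_singleton_add_one hu' hfin.sdiff
  have hone : ((nbrs H W a \ {v}) \ {u}).ncard = 1 := by omega
  obtain ⟨t, ht⟩ := Set.ncard_eq_one.1 hone
  have htm : t ∈ (nbrs H W a \ {v}) \ {u} := by rw [ht]; rfl
  refine ⟨t, htm.2, htm.1.2, ?_⟩
  rw [← ht]
  ext z
  simp only [Set.mem_insert_iff, Set.mem_sdiff, Set.mem_singleton_iff]
  grind

/-- The vertex that arises by a contraction has degree less than three only if the ends of the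
contracted edge have degree three and the same two further neighbours. -/
lemma nbrs_eq_of_ncard_contract_self_lt (hW : W.Finite) {u v : α} (hu : u ∈ W) (hv : v ∈ W)
    (huv : H.Adj u v) (hu3 : 3 ≤ (nbrs H W u).ncard) (hv3 : 3 ≤ (nbrs H W v).ncard)
    (hlt : (nbrs (contract H u v) (W \ {v}) u).ncard < 3) :
    ∃ a b, a ≠ b ∧ nbrs H W u = {v, a, b} ∧ nbrs H W v = {u, a, b} := by
  set P := nbrs (contract H u v) (W \ {v}) u
  have hfin' : P.Finite := finite_nbrs hW.sdiff u
  have hvu : v ∈ nbrs H W u := ⟨huv, hv⟩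
  have huv' : u ∈ nbrs H W v := ⟨huv.symm, hu⟩
  have h₁ : nbrs H W u \ {v} = P := by
    refine Set.eq_of_subset_of_ncard_le ?_ ?_ hfin'
    · exact fun z ⟨⟨h, hz⟩, hzv⟩ => ⟨contract_adj.2 (Or.inl h), hz, hzv⟩
    · have := Set.ncard_sdiff_singleton_add_one hvu (finite_nbrs hW u)
      omega
  have h₂ : nbrs H W v \ {u} = P := by
    refine Set.eq_of_subset_of_ncard_le ?_ ?_ hfin'
    · rintro z ⟨⟨h, hz⟩, hzu⟩
      exact ⟨contract_adj.2 (Or.inr ⟨Ne.symm hzu, Or.inl ⟨rfl, h⟩⟩), hz, h.ne'⟩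
    · have := Set.ncard_sdiff_singleton_add_one huv' (finite_nbrs hW v)
      omega
  have hcard : P.ncard = 2 := by
    have := Set.ncard_sdiff_singleton_add_one hvu (finite_nbrs hW u)
    rw [h₁] at this
    omega
  obtain ⟨a, b, hab, hP⟩ := Set.ncard_eq_two.1 hcard
  refine ⟨a, b, hab, ?_, ?_⟩
  · rw [← hP, ← h₁, Set.insert_sdiff_singleton, Set.insert_eq_of_mem hvu]
  · rw [← hP, ← h₂, Set.insert_sdiff_singleton, Set.insert_eq_of_mem huv']

/-- Let `p` and `q` be adjacent vertices of degree three with the same further neighbours `a` and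
`b`. If `a` and `b` are joined outside `{p, q}`, there is a `K₄` minor; otherwise one of the
components of `a` and `b` avoids the edge `xy`, and is smaller. -/
lemma hasK4Model_of_diamond {x y p q a b : α} (hxy : x = y ∨ H.Adj x y)
    (hdeg : ∀ v ∈ W, v ≠ x → v ≠ y → 3 ≤ (nbrs H W v).ncard)
    (ih : ∀ W' ⊂ W, ∀ c, (∃ v ∈ W', v ≠ c) → (∀ v ∈ W', v ≠ c → 3 ≤ (nbrs H W' v).ncard) →
      HasK4Model H W')
    (hW : W.Finite) (hpW : p ∈ W) (hqW : q ∈ W) (hab : a ≠ b)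
    (hp : nbrs H W p = {q, a, b}) (hq : nbrs H W q = {p, a, b}) : HasK4Model H W := by
  have hpq : H.Adj p q := (hp.symm ▸ (by simp) : q ∈ nbrs H W p).1
  obtain ⟨hpa, haW⟩ : a ∈ nbrs H W p := hp.symm ▸ (by simp)
  obtain ⟨hpb, hbW⟩ : b ∈ nbrs H W p := hp.symm ▸ (by simp)
  have hqa : H.Adj q a := (hq.symm ▸ (by simp) : a ∈ nbrs H W q).1
  have hqb : H.Adj q b := (hq.symm ▸ (by simp) : b ∈ nbrs H W q).1
  have haY : a ∈ W \ {p, q} := ⟨haW, by simp [hpa.ne', hqa.ne']⟩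
  have hbY : b ∈ W \ {p, q} := ⟨hbW, by simp [hpb.ne', hqb.ne']⟩
  by_cases hr : b ∈ reachSet H (W \ {p, q}) a
  · obtain ⟨z, hz, hzb⟩ := exists_adj_reachSet_diff hab hr
    have haA := self_mem_reachSet (H := H) (Y := (W \ {p, q}) \ {b}) ⟨haY, hab⟩
    have hA : reachSet H ((W \ {p, q}) \ {b}) a ⊆ (W \ {p, q}) \ {b} := reachSet_subset
    refine hasK4Model_of_sets (A := reachSet H ((W \ {p, q}) \ {b}) a) (B := {b}) (C := {p})
      (D := {q}) (connected_reachSet ⟨haY, hab⟩) (connected_induce_singleton _)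
      (connected_induce_singleton _) (connected_induce_singleton _)
      (fun z hz => (hA hz).1.1) (by simpa using hbW) (by simpa using hpW) (by simpa using hqW)
      (Set.disjoint_singleton_right.2 fun h => (hA h).2 rfl)
      (Set.disjoint_singleton_right.2 fun h => (hA h).1.2 (by simp))
      (Set.disjoint_singleton_right.2 fun h => (hA h).1.2 (by simp))
      (by simpa using hpb.ne') (by simpa using hqb.ne') (by simpa using hpq.ne)
      ⟨z, hz, b, rfl, hzb⟩ ⟨a, haA, p, rfl, hpa.symm⟩ ⟨a, haA, q, rfl, hqa.symm⟩
      ⟨b, rfl, p, rfl, hpb.symm⟩ ⟨b, rfl, q, rfl, hqb.symm⟩ ⟨p, rfl, q, rfl, hpq⟩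
  · have key : ∀ a b, a ∈ W \ {p, q} → b ∉ reachSet H (W \ {p, q}) a →
        nbrs H W p = {q, a, b} → nbrs H W q = {p, a, b} →
        x ∉ reachSet H (W \ {p, q}) a → y ∉ reachSet H (W \ {p, q}) a → HasK4Model H W := by
      intro a b haY hb hp hq hx hy
      set A := reachSet H (W \ {p, q}) a
      have hAY : A ⊆ W \ {p, q} := reachSet_subset
      have haA : a ∈ A := self_mem_reachSet haY
      have hAW : A ⊆ W := fun z hz => (hAY hz).1
      have ha3 := hdeg a haY.1 (fun h => hx (h ▸ haA)) (fun h => hy (h ▸ haA))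
      obtain ⟨c, hc, hcpq⟩ := Set.exists_mem_notMem_of_ncard_lt_ncard
        (lt_of_le_of_lt (ncard_pair_le p q) ha3)
      refine (ih A ⟨hAW, fun h => (hAY (h hpW)).2 (by simp)⟩ a
        ⟨c, mem_reachSet_of_adj haA ⟨hc.2, hcpq⟩ hc.1, hc.1.ne'⟩ ?_).mono hAW
      intro v hv hva
      refine (hdeg v (hAW hv) (fun h => hx (h ▸ hv)) (fun h => hy (h ▸ hv))).trans
        (Set.ncard_le_ncard ?_ (finite_nbrs (hW.subset hAW) v))
      rintro z ⟨hvz, hzW⟩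
      refine ⟨hvz, mem_reachSet_of_adj hv ⟨hzW, ?_⟩ hvz⟩
      have hvb : v ≠ b := fun h => hb (h ▸ hv)
      have hvpq := (hAY hv).2
      rintro (rfl | rfl)
      · have : v ∈ nbrs H W z := ⟨hvz.symm, hAW hv⟩
        rw [hp] at this
        simp at this hvpq
        grind
      · have : v ∈ nbrs H W z := ⟨hvz.symm, hAW hv⟩
        rw [hq] at this
        simp at this hvpq
        grind
    have hsymm : ∀ {c d}, d ∈ reachSet H (W \ {p, q}) c → c ∈ reachSet H (W \ {p, q}) d :=
      fun ⟨hc, hd, h⟩ => ⟨hd, hc, h.symm⟩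
    have hdisjoint : ∀ z, z ∈ reachSet H (W \ {p, q}) a → z ∉ reachSet H (W \ {p, q}) b := by
      rintro z ⟨_, _, h⟩ ⟨_, _, h'⟩
      exact hr ⟨haY, hbY, h.trans h'.symm⟩
    by_cases hK : x ∉ reachSet H (W \ {p, q}) a ∧ y ∉ reachSet H (W \ {p, q}) a
    · exact key a b haY hr hp hq hK.1 hK.2
    · have hcross : ∀ x y, (x = y ∨ H.Adj x y) → x ∈ reachSet H (W \ {p, q}) a →
          x ∉ reachSet H (W \ {p, q}) b ∧ y ∉ reachSet H (W \ {p, q}) b := by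
        intro x y hxy hx
        refine ⟨hdisjoint x hx, ?_⟩
        rcases hxy with rfl | hxy
        · exact hdisjoint x hx
        · exact fun hy => hdisjoint y (mem_reachSet_of_adj hx (reachSet_subset hy) hxy) hy
      have hK' : x ∉ reachSet H (W \ {p, q}) b ∧ y ∉ reachSet H (W \ {p, q}) b := by
        by_cases hx : x ∈ reachSet H (W \ {p, q}) a
        · exact hcross x y hxy hx
        · have hy : y ∈ reachSet H (W \ {p, q}) a := by tauto
          exact (hcross y x (hxy.imp Eq.symm fun h => h.symm) hy).symm
      refine key b a hbY (fun h => hr (hsymm h)) ?_ ?_ hK'.1 hK'.2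
      · rw [hp, Set.pair_comm]
      · rw [hq, Set.pair_comm]

/-- A finite graph has a `K₄` minor if it has a vertex besides the ends `x` and `y` of some edge, and
all such vertices have degree at least three. If `x = y`, only that vertex is excepted. -/
theorem hasK4Model_of_three_le_ncard_nbrs (hW : W.Finite) {x y : α} (hxy : x = y ∨ H.Adj x y)
    (hne : ∃ v ∈ W, v ≠ x ∧ v ≠ y)
    (hdeg : ∀ v ∈ W, v ≠ x → v ≠ y → 3 ≤ (nbrs H W v).ncard) : HasK4Model H W := by
  induction hn : W.ncard using Nat.strong_induction_on generalizing H W x y with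
  | _ n ih =>
  subst hn
  by_contra hno
  have hdiamond : ∀ p q a b, p ∈ W → q ∈ W → a ≠ b →
      nbrs H W p = {q, a, b} → nbrs H W q = {p, a, b} → False := by
    intro p q a b hp hq hab hpn hqn
    refine hno (hasK4Model_of_diamond hxy hdeg ?_ hW hp hq hab hpn hqn)
    intro W' hW' c hne' hdeg'
    exact ih _ (Set.ncard_lt_ncard hW' hW) (hW.subset hW'.1) (Or.inl (rfl : c = c))
      (by simpa using hne') (fun v hv hvc _ => hdeg' v hv hvc) rfl
  -- every edge outside `xy` is in a triangle with a vertex of degree three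
  have htriangle : ∀ u v, u ∈ W → v ∈ W → v ≠ x → v ≠ y → H.Adj u v →
      ∃ a ∈ W, a ≠ x ∧ a ≠ y ∧ ∃ t, t ≠ u ∧ t ≠ v ∧ nbrs H W a = {u, v, t} := by
    intro u v hu hv hvx hvy huv
    by_contra! hcon
    refine hno (HasK4Model.of_contract hu hv huv ?_)
    refine ih _ (Set.ncard_sdiff_singleton_lt_of_mem hv hW) hW.sdiff
      (hxy.imp id fun h => contract_adj.2 (Or.inl h)) ?_ ?_ rfl
    · obtain ⟨c, hc, hcxy⟩ := Set.exists_mem_notMem_of_ncard_lt_ncard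
        (lt_of_le_of_lt (ncard_pair_le x y) (hdeg v hv hvx hvy))
      simp only [Set.mem_insert_iff, Set.mem_singleton_iff, not_or] at hcxy
      exact ⟨c, ⟨hc.2, hc.1.ne'⟩, hcxy⟩
    · rintro a ⟨ha, hav⟩ hax hay
      by_contra! hlt
      by_cases hau : a = u
      · subst hau
        obtain ⟨c, d, hcd, h₁, h₂⟩ := nbrs_eq_of_ncard_contract_self_lt hW hu hv huv
          (hdeg a hu hax hay) (hdeg v hv hvx hvy) hlt
        exact hdiamond a v c d hu hv hcd h₁ h₂
      · obtain ⟨t, htu, htv, ht⟩ := nbrs_eq_of_ncard_contract_lt hW hu huv.ne hau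
          (hdeg a ha hax hay) hlt
        exact hcon a ha hax hay t htu htv ht
  obtain ⟨v, hv, hvx, hvy⟩ := hne
  obtain ⟨u, hu⟩ : (nbrs H W v).Nonempty := by
    rw [← Set.ncard_pos (finite_nbrs hW v)]
    exact lt_of_lt_of_le (by norm_num) (hdeg v hv hvx hvy)
  have huv : H.Adj u v := hu.1.symm
  obtain ⟨w, hw, hwx, hwy, t, htu, htv, hwn⟩ := htriangle u v hu.2 hv hvx hvy huv
  have hwt : t ∈ nbrs H W w := by simp [hwn]
  have hwu : u ∈ nbrs H W w := by simp [hwn]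
  have hwv : v ∈ nbrs H W w := by simp [hwn]
  obtain ⟨a, ha, hax, hay, s, hst, hsw, han⟩ := htriangle t w hwt.2 hw hwx hwy hwt.1.symm
  have haw : a ∈ nbrs H W w := ⟨(by simp [han] : w ∈ nbrs H W a).1.symm, ha⟩
  have hat : H.Adj a t := (by simp [han] : t ∈ nbrs H W a).1
  rw [hwn] at haw
  simp only [Set.mem_insert_iff, Set.mem_singleton_iff] at haw
  rcases haw with rfl | rfl | rfl
  · have hvs : v ∈ nbrs H W a := ⟨huv, hv⟩
    have hvs' := hvs
    rw [han] at hvs'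
    simp only [Set.mem_insert_iff, Set.mem_singleton_iff] at hvs'
    obtain rfl : v = s := by
      rcases hvs' with h | h | h
      · exact absurd h.symm htv
      · exact absurd h hwv.1.ne'
      · exact h
    refine hdiamond w a v t hw ha htv.symm hwn ?_
    rw [han]
    ext z
    simp only [Set.mem_insert_iff, Set.mem_singleton_iff]
    tauto
  · have hus : u ∈ nbrs H W a := ⟨huv.symm, hu.2⟩
    have hus' := hus
    rw [han] at hus'
    simp only [Set.mem_insert_iff, Set.mem_singleton_iff] at hus'
    obtain rfl : u = s := by
      rcases hus' with h | h | h
      · exact absurd h.symm htu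
      · exact absurd h hwu.1.ne'
      · exact h
    refine hdiamond w a u t hw ha htu.symm ?_ ?_
    · rw [hwn]
      ext z
      simp only [Set.mem_insert_iff, Set.mem_singleton_iff]
      tauto
    · rw [han]
      ext z
      simp only [Set.mem_insert_iff, Set.mem_singleton_iff]
      tauto
  · exact absurd hat (H.irrefl)

end MinDegree

/-! ### Translation between multigraphs and simple graphs -/

section Translation

variable {G : Graph α β} {s Y : Set α}

lemma toSimple_induce_adj {x y : α} : (toSimple (G.induce Y)).Adj x y ↔
    (toSimple G).Adj x y ∧ x ∈ Y ∧ y ∈ Y := by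
  simp only [toSimple, Graph.Adj, Graph.induce_isLink]
  grind

lemma induce_toSimple_induce (h : s ⊆ Y) :
    (toSimple (G.induce Y)).induce s = (toSimple G).induce s := by
  ext x y
  simp only [SimpleGraph.comap_adj, Function.Embedding.subtype_apply, toSimple_induce_adj]
  exact ⟨fun h' => h'.1, fun h' => ⟨h', h x.2, h y.2⟩⟩

lemma isConnected_induce_iff :
    IsConnected (G.induce s) ↔ ((toSimple G).induce s).Connected := by
  rw [connected_induce_iff]
  constructor
  · rintro ⟨hne, h⟩
    refine ⟨hne, fun T hTs ⟨a, ha⟩ hT b hb => ?_⟩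
    refine mem_of_reachable (h a (hTs ha) b hb).2.2 ha fun p hp q hpq => ?_
    rw [toSimple_induce_adj] at hpq
    exact hT p hp q hpq.2.2 hpq.1
  · rintro ⟨hne, h⟩
    refine ⟨hne, fun x hx y hy => ⟨hx, hy, ?_⟩⟩
    refine (h {z | z ∈ s ∧ (toSimple (G.induce s)).Reachable x z} (fun _ h => h.1)
      ⟨x, hx, SimpleGraph.Reachable.refl _⟩ ?_ hy).2
    rintro p ⟨hp, hr⟩ q hq hpq
    exact ⟨hq, hr.trans (toSimple_induce_adj.2 ⟨hpq, hp, hq⟩).reachable⟩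

lemma HasK4Minor.hasK4Model (h : HasK4Minor G) : HasK4Model (toSimple G) G.vertexSet := by
  obtain ⟨B, hB, hd, hadj⟩ := h
  refine ⟨B, fun i => ⟨(hB i).1, isConnected_induce_iff.1 (hB i).2⟩, hd, fun i j hij => ?_⟩
  obtain ⟨x, hx, y, hy, h⟩ := hadj i j hij
  refine ⟨x, hx, y, hy, ?_, h⟩
  rintro rfl
  exact Set.disjoint_left.1 (hd i j hij) hx hy

lemma HasK4Model.hasK4Subdivision_induce (h : HasK4Model (toSimple G) Y) :
    HasK4Subdivision (G.induce Y) := by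
  obtain ⟨B, hB, hd, hadj⟩ := h
  refine hasK4Subdivision_of_hasK4Model (W := Y)
    ⟨B, fun i => ⟨(hB i).1, ?_⟩, hd, fun i j hij => ?_⟩
  · rw [induce_toSimple_induce (hB i).1]
    exact (hB i).2
  · obtain ⟨x, hx, y, hy, h⟩ := hadj i j hij
    exact ⟨x, hx, y, hy, toSimple_induce_adj.2 ⟨h, (hB i).1 hx, (hB j).1 hy⟩⟩

/-- No vertex separates two further vertices of a block. -/
lemma IsBlock.mem_reachSet {B : Graph α β} (hB : IsBlock (G.induce s) B) {x y u : α}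
    (hx : x ∈ B.vertexSet) (hy : y ∈ B.vertexSet) (hxu : u ≠ x) (hyu : u ≠ y) :
    y ∈ reachSet (toSimple G) (s \ {u}) x := by
  obtain ⟨⟨hle, hconn, hcut⟩, -⟩ := hB
  have hxy := hconn.2 x hx y hy
  have hadj : ∀ p q, B.Adj p q → G.Adj p q ∧ q ∈ s := by
    rintro p q ⟨e, he⟩
    have := hle.isLink_mono he
    rw [Graph.induce_isLink] at this
    exact ⟨⟨e, this.1⟩, this.2.2⟩
  have hxs : x ∈ s := hle.vertexSet_mono hx
  have hxR : x ∈ reachSet (toSimple G) (s \ {u}) x :=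
    self_mem_reachSet ⟨hxs, fun h => hxu (Set.mem_singleton_iff.1 h).symm⟩
  by_cases hu : u ∈ B.vertexSet
  · have hsep : SameComponent (B.deleteVerts {u}) x y := by
      by_contra hsep
      exact hcut u ⟨hu, x, y, hxu.symm, hyu.symm, hxy, hsep⟩
    refine mem_of_reachable hsep.2.2 hxR fun p hp q hpq => ?_
    obtain ⟨hne, e, he⟩ := hpq
    simp only [Graph.deleteVerts_isLink] at he
    have := hadj p q ⟨e, he.1⟩
    refine mem_reachSet_of_adj hp ⟨this.2, ?_⟩ ⟨hne, this.1⟩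
    simpa using he.2.2
  · refine mem_of_reachable hxy.2.2 hxR fun p hp q hpq => ?_
    have := hadj p q hpq.2
    refine mem_reachSet_of_adj hp ⟨this.2, ?_⟩ ⟨hpq.1, this.1⟩
    rintro rfl
    exact hu hpq.2.right_mem

/-- An isolated vertex forms a component. -/
lemma isComponent_singleton {v : α} (hv : v ∈ G.vertexSet) (h : ∀ z, ¬ (toSimple G).Adj v z) :
    IsComponent G {v} := by
  refine ⟨v, hv, ?_⟩
  ext w
  refine ⟨?_, fun hw => ?_⟩
  · rintro rfl
    exact ⟨hv, hv, SimpleGraph.Reachable.refl _⟩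
  · refine mem_of_reachable (T := {v}) hw.2.2 rfl ?_
    rintro p rfl q hpq
    exact absurd hpq (h q)

end Translation

/-! ### Degrees in reduced instances -/

namespace Instance

variable {I : Instance α β}

lemma toSimple_adj {x y : α} : (toSimple I.G).Adj x y ↔ I.G.Adj x y := by
  refine ⟨fun h => h.2, fun h => ⟨?_, h⟩⟩
  rintro rfl
  obtain ⟨e, he⟩ := h
  exact I.loopless.not_isLoopAt e x he

lemma IsReduced.eq_of_isLink (hred : I.IsReduced) {u v : α} (hv : v ∈ I.F) {e f : β}
    (he : I.G.IsLink e v u) (hf : I.G.IsLink f v u) : e = f := by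
  by_contra hne
  exact hred.2.2.1 ⟨u, he.right_mem, v, hv, e, f, hne, he.symm, hf.symm⟩

/-- Without parallel edges at `v`, the degree of `v` is its number of neighbours. -/
lemma IsReduced.degree_eq (hred : I.IsReduced) {v : α} (hv : v ∈ I.F) :
    degree I.G v = {z | I.G.Adj v z}.ncard := by
  refine Set.ncard_congr (fun e (he : I.G.Inc e v) => he.other) ?_ ?_ ?_
  · exact fun e he => ⟨e, Graph.Inc.isLink_other he⟩
  · intro e f he hf h
    refine hred.eq_of_isLink hv (Graph.Inc.isLink_other he) ?_
    rw [h]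
    exact Graph.Inc.isLink_other hf
  · rintro z ⟨e, he⟩
    exact ⟨e, he.inc_left, (Graph.Inc.isLink_other he.inc_left).right_unique he⟩

lemma finite_setOf_adj (v : α) : {z | I.G.Adj v z}.Finite :=
  I.finite_vertexSet.subset fun _ h => h.right_mem

/-- A vertex of `F` with at most one neighbour would be a component of `G`, or of `G` minus its only
edge, and the 1-boundary rule would apply to it. -/
lemma IsReduced.two_le_ncard_adj (hred : I.IsReduced) {v : α} (hv : v ∈ I.F) :
    2 ≤ {z | I.G.Adj v z}.ncard := by
  by_contra! hlt
  refine hred.1 ⟨{v}, by simpa using hv, Or.inl ?_⟩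
  have hcases : {z | I.G.Adj v z}.ncard = 0 ∨ {z | I.G.Adj v z}.ncard = 1 := by omega
  rcases hcases with h | h
  · rw [Set.ncard_eq_zero (finite_setOf_adj v)] at h
    exact Or.inl (isComponent_singleton hv.1 fun z hz =>
      h.subset (show z ∈ {z | I.G.Adj v z} from hz.2))
  · obtain ⟨w, hw⟩ := Set.ncard_eq_one.1 h
    obtain ⟨e, he⟩ : I.G.Adj v w := (hw.symm.subset rfl : w ∈ {z | I.G.Adj v z})
    have hiso : ∀ z, ¬ (toSimple (I.G.deleteEdges {e})).Adj v z := by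
      rintro z ⟨-, f, hf⟩
      simp only [Graph.deleteEdges_isLink, Set.mem_singleton_iff] at hf
      obtain rfl : z = w := hw.subset (⟨f, hf.1⟩ : I.G.Adj v z)
      exact hf.2 (hred.eq_of_isLink hv hf.1 he)
    refine Or.inr ⟨e, ⟨v, w, he, fun hvw => ?_⟩, isComponent_singleton hv.1 hiso⟩
    have : w ∈ ({v} : Set α) := by
      refine mem_of_reachable hvw.2.2 rfl ?_
      rintro p rfl q hpq
      exact absurd hpq (hiso q)
    rw [Set.mem_singleton_iff.1 this] at he
    exact I.loopless.not_isLoopAt e v he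

/-- A vertex of `F` of degree two with a neighbour in `F` would be bypassed. -/
lemma IsReduced.three_le_ncard_adj (hred : I.IsReduced) {v u : α} (hv : v ∈ I.F) (hu : u ∈ I.F)
    (hvu : I.G.Adj v u) : 3 ≤ {z | I.G.Adj v z}.ncard := by
  by_contra! hlt
  have h2 : {z | I.G.Adj v z}.ncard = 2 := by
    have := hred.two_le_ncard_adj hv
    omega
  obtain ⟨w, hw, hwu⟩ := Set.exists_ne_of_one_lt_ncard (by omega : 1 < {z | I.G.Adj v z}.ncard) u
  exact hred.2.1 ⟨v, hv, (hred.degree_eq hv).trans h2, w, Graph.Adj.right_mem hw, u, hu, hwu,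
    hw, hvu⟩

/-! ### The components of `G[F]` -/

/-- No branching rule applies to a connected subset of `F`. -/
def NoBranching (I : Instance α β) : Prop :=
  ∀ X ⊆ I.F, IsConnected (I.G.induce X) →
    ¬ I.BranchingRule1Applies X ∧ ¬ I.BranchingRule2Applies X ∧ ¬ I.BranchingRule3Applies X

/-- The neighbours in `S` of the vertices of `X`. -/
def attachments (I : Instance α β) (X : Set α) : Set α := {s | s ∈ I.S ∧ ∃ v ∈ X, I.G.Adj v s}

lemma finite_S (I : Instance α β) : I.S.Finite := I.finite_vertexSet.subset I.cover.1

section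

variable {X : Set α}

lemma NoBranching.not_hasK4Model (hbr : I.NoBranching) (hX : X ⊆ I.F)
    (hconn : ((toSimple I.G).induce X).Connected) : ¬ HasK4Model (toSimple I.G) (I.S ∪ X) :=
  fun h => (hbr X hX (isConnected_induce_iff.2 hconn)).1 ⟨hX, h.hasK4Subdivision_induce⟩

lemma NoBranching.exists_isBlock (hbr : I.NoBranching) (hX : X ⊆ I.F)
    (hconn : ((toSimple I.G).induce X).Connected) {s t : α} (hs : s ∈ I.attachments X)
    (ht : t ∈ I.attachments X) (hst : s ≠ t) :
    ∃ B, IsBlock I.GS B ∧ s ∈ B.vertexSet ∧ t ∈ B.vertexSet := by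
  have hconn' := isConnected_induce_iff.2 hconn
  obtain ⟨-, h2, h3⟩ := hbr X hX hconn'
  by_contra hB
  have hsame : SameComponent I.GS s t := by
    by_contra hsame
    exact h2 ⟨hX, hconn', s, hs.1, t, ht.1, hst, hs.2, ht.2, hsame⟩
  exact h3 ⟨hX, hconn', s, hs.1, t, ht.1, hst, hs.2, ht.2, hsame, hB⟩

lemma NoBranching.mem_reachSet (hbr : I.NoBranching) (hX : X ⊆ I.F)
    (hconn : ((toSimple I.G).induce X).Connected) {s t : α} (hs : s ∈ I.attachments X)
    (ht : t ∈ I.attachments X) (hst : s ≠ t) (u : α) (hus : u ≠ s) (hut : u ≠ t) :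
    t ∈ reachSet (toSimple I.G) (I.S \ {u}) s := by
  obtain ⟨B, hB, hsB, htB⟩ := hbr.exists_isBlock hX hconn hs ht hst
  exact hB.mem_reachSet hsB htB hus hut

/-- Three attachments would be the roots of a triangle minor of `G[S]`, to which `X` is a fourth
branch set. -/
lemma NoBranching.ncard_attachments_le_two (hbr : I.NoBranching) (hX : X ⊆ I.F)
    (hconn : ((toSimple I.G).induce X).Connected) : (I.attachments X).ncard ≤ 2 := by
  by_contra! hlt
  obtain ⟨a, b, c, ha, hb, hc, hab, hac, hbc⟩ :=
    (Set.two_lt_ncard_iff (I.finite_S.subset fun _ h => h.1)).1 hlt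
  have hsep := fun {s t : α} => hbr.mem_reachSet hX hconn (s := s) (t := t)
  obtain ⟨A, B, C, ⟨hAS, hA, haA⟩, ⟨hBS, hB, hbB⟩, ⟨hCS, hC, hcC⟩, dAB, dAC, dBC, eAB, eAC, eBC⟩ :=
    exists_rooted_triangle I.finite_S hac (hsep ha hb hab)
      (fun u hua huc => hsep hc ha hac.symm u huc hua)
      (fun u hub huc => hsep hc hb hbc.symm u huc hub) hab hbc
  have hXS : ∀ {D}, D ⊆ I.S → Disjoint D X := fun hD =>
    Set.disjoint_left.2 fun z hz hzX => (hX hzX).2 (hD hz)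
  have hXadj : ∀ {D : Set α} {s : α}, s ∈ D → s ∈ I.attachments X →
      ∃ x ∈ D, ∃ y ∈ X, (toSimple I.G).Adj x y :=
    fun {D s} hsD ⟨_, v, hv, h⟩ => ⟨s, hsD, v, hv, toSimple_adj.2 h.symm⟩
  have hsub : ∀ {D}, D ⊆ I.S → D ⊆ I.S ∪ X := fun hD => hD.trans Set.subset_union_left
  exact hbr.not_hasK4Model hX hconn (hasK4Model_of_sets hA hB hC hconn (hsub hAS) (hsub hBS)
    (hsub hCS) Set.subset_union_right dAB dAC (hXS hAS) dBC (hXS hBS) (hXS hCS)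
    eAB eAC (hXadj haA ha) eBC (hXadj hbB hb) (hXadj hcC hc))

end

/-- The components of `G[F]` are single vertices. In a larger one, `X`, all vertices have degree at
least three. Together with its at most two attachments, which are joined by an edge, it therefore
has a `K₄` minor; the edge is a minor of `G[S]`. -/
lemma IsReduced.reachSet_F_eq_singleton (hred : I.IsReduced) (hbr : I.NoBranching) {v : α}
    (hv : v ∈ I.F) :
    reachSet (toSimple I.G) I.F v = {v} := by
  set H := toSimple I.G with hH
  set X := reachSet H I.F v with hXdef
  have hvX : v ∈ X := self_mem_reachSet hv
  have hX : X ⊆ I.F := reachSet_subset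
  have hconn : (H.induce X).Connected := connected_reachSet hv
  by_contra hne
  obtain ⟨u, hu, huv⟩ : ∃ u ∈ X, u ≠ v := by
    by_contra! hcon
    exact hne (Set.eq_singleton_iff_unique_mem.2 ⟨hvX, hcon⟩)
  have hno := hbr.not_hasK4Model hX hconn
  have hW : ∀ {N : Set α}, N ⊆ I.S → (X ∪ N).Finite := fun hN =>
    (I.finite_vertexSet.subset fun z hz => (hX hz).1).union (I.finite_S.subset hN)
  have hNS : I.attachments X ⊆ I.S := fun _ h => h.1
  have hdeg : ∀ z ∈ X, 3 ≤ {w | I.G.Adj z w}.ncard := by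
    intro z hz
    obtain ⟨w, hw, hzw⟩ : ∃ w ∈ X, H.Adj z w := by
      by_contra! hcon
      have hsub := (connected_induce_iff.1 hconn).2 {z} (by simpa using hz) ⟨z, rfl⟩
        (by rintro p rfl q hq hpq; exact absurd hpq (hcon q hq))
      exact huv ((hsub hu).trans (hsub hvX).symm)
    exact hred.three_le_ncard_adj (hX hz) (hX hw) (toSimple_adj.1 hzw)
  have hnbrs : ∀ z ∈ X, ∀ w, I.G.Adj z w → w ∈ X ∪ I.attachments X := by
    intro z hz w hzw
    by_cases hwS : w ∈ I.S
    · exact Or.inr ⟨hwS, z, hz, hzw⟩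
    · exact Or.inl (mem_reachSet_of_adj hz ⟨hzw.right_mem, hwS⟩ (toSimple_adj.2 hzw))
  have hle : ∀ {H' : SimpleGraph α}, H ≤ H' → ∀ z ∈ X,
      3 ≤ (nbrs H' (X ∪ I.attachments X) z).ncard := by
    intro H' hH' z hz
    refine (hdeg z hz).trans (Set.ncard_le_ncard ?_ (finite_nbrs (hW hNS) z))
    exact fun w hw => ⟨hH' (toSimple_adj.2 hw), hnbrs z hz w hw⟩
  by_cases hN : ∃ x, I.attachments X ⊆ {x}
  · -- if there is no attachment, `x` is arbitrary, and may be one of `u` and `v`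
    obtain ⟨x, hx⟩ := hN
    refine hno ((hasK4Model_of_three_le_ncard_nbrs (hW hNS) (Or.inl (rfl : x = x)) ?_ ?_).mono
      (W' := I.S ∪ X) (Set.union_subset Set.subset_union_right
        (hNS.trans Set.subset_union_left)))
    · by_cases hvx : v = x
      · exact ⟨u, Or.inl hu, by rwa [← hvx], by rwa [← hvx]⟩
      · exact ⟨v, Or.inl hvX, hvx, hvx⟩
    · intro z hz hzx _
      exact hle le_rfl z (hz.resolve_right fun h => hzx (hx h))
  · obtain ⟨x, y, hxy, hxyN⟩ : ∃ x y, x ≠ y ∧ I.attachments X = {x, y} := by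
      rw [← Set.ncard_eq_two]
      have h1 := hbr.ncard_attachments_le_two hX hconn
      by_contra hne2
      have : Nonempty α := ⟨v⟩
      refine hN ((Set.ncard_le_one_iff_subset_singleton
        (s := I.attachments X) (hs := I.finite_S.subset hNS)).1 (by omega))
    have hx : x ∈ I.attachments X := by simp [hxyN]
    have hy : y ∈ I.attachments X := by simp [hxyN]
    have hvS : v ∉ I.S := hv.2
    have hreach := hbr.mem_reachSet hX hconn hx hy hxy v (fun h => hvS (h ▸ hx.1))
      (fun h => hvS (h ▸ hy.1))
    rw [Set.sdiff_singleton_eq_self hvS] at hreach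
    obtain ⟨p, hp, hpy⟩ := exists_adj_reachSet_diff hxy hreach
    set A := reachSet H (I.S \ {y}) x with hA
    have hxA : x ∈ A := self_mem_reachSet ⟨hx.1, hxy⟩
    have hAS : A ⊆ I.S \ {y} := reachSet_subset
    -- in the minor with the additional edge `xy`, the vertex `x` stands for `A`
    obtain ⟨φ, hφx, hφ⟩ : ∃ φ : α → Set α, φ x = A ∧ ∀ a, a ≠ x → φ a = {a} := by
      classical
      exact ⟨fun a => if a = x then A else {a}, if_pos rfl, fun a ha => if_neg ha⟩
    have mem : ∀ a, a ∈ φ a := by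
      intro a
      by_cases ha : a = x
      · rwa [ha, hφx]
      · rw [hφ a ha]
        rfl
    have hxX : ∀ z ∈ X, z ∉ I.S := fun z hz => (hX hz).2
    have hdisj : ∀ b ∈ X ∪ I.attachments X, b ≠ x → b ∉ A := by
      rintro b (hb | hb) hbx hbA
      · exact hxX b hb (hAS hbA).1
      · rw [hxyN] at hb
        rcases hb with rfl | rfl
        · exact hbx rfl
        · exact (hAS hbA).2 rfl
    have hmodel : HasK4Model (H ⊔ SimpleGraph.edge x y) (X ∪ I.attachments X) := by
      refine hasK4Model_of_three_le_ncard_nbrs (hW hNS) (x := x) (y := y) (Or.inr ?_) ?_ ?_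
      · exact Or.inr (by simp [SimpleGraph.edge_adj, hxy])
      · exact ⟨v, Or.inl hvX, fun h => hvS (h ▸ hx.1), fun h => hvS (h ▸ hy.1)⟩
      · rintro z (hz | hz) hzx hzy
        · exact hle le_sup_left z hz
        · rw [hxyN] at hz
          rcases hz with rfl | rfl
          · exact absurd rfl hzx
          · exact absurd rfl hzy
    refine hno (hmodel.lift φ ?_ ?_ ?_)
    · intro a ha
      by_cases hax : a = x
      · rw [hax, hφx]
        exact ⟨fun z hz => Or.inl (hAS hz).1, connected_reachSet ⟨hx.1, hxy⟩⟩
      · rw [hφ a hax]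
        exact ⟨by simpa using ha.symm.imp (fun h => hNS h) id, connected_induce_singleton a⟩
    · intro a ha b hb hab
      by_cases hax : a = x
      · have hbx : b ≠ x := fun h => hab (hax.trans h.symm)
        rw [hax, hφx, hφ b hbx]
        exact Set.disjoint_singleton_right.2 (hdisj b hb hbx)
      · by_cases hbx : b = x
        · rw [hbx, hφx, hφ a hax]
          exact Set.disjoint_singleton_left.2 (hdisj a ha hax)
        · rw [hφ a hax, hφ b hbx]
          simpa using hab
    · rintro a ha b hb (hab | hab)
      · exact ⟨a, mem a, b, mem b, hab⟩
      · rw [SimpleGraph.edge_adj] at hab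
        rcases hab with ⟨⟨rfl, rfl⟩ | ⟨rfl, rfl⟩, -⟩
        · exact ⟨p, hφx ▸ hp, b, mem b, hpy⟩
        · exact ⟨a, mem a, p, hφx ▸ hp, hpy.symm⟩

end Instance

end K4Cover

theorem mainTheorem4 {α : Type*} {β : Type*} (I : K4Cover.Instance α β)
    (hred : I.IsReduced)
    (hbranch : ∀ X ⊆ I.F, K4Cover.IsConnected (I.G.induce X) →
      ¬ I.BranchingRule1Applies X ∧ ¬ I.BranchingRule2Applies X ∧ ¬ I.BranchingRule3Applies X) :
    I.IsIndependent := by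
  have hbr : I.NoBranching := hbranch
  have hind : ∀ u ∈ I.F, ∀ v ∈ I.F, ¬ I.G.Adj u v := by
    intro u hu v hv huv
    have huv' := K4Cover.Instance.toSimple_adj.2 huv
    have hmem := K4Cover.mem_reachSet_of_adj (K4Cover.self_mem_reachSet hu) hv huv'
    rw [hred.reachSet_F_eq_singleton hbr hu] at hmem
    exact huv'.ne' hmem
  have hsub : ∀ v ∈ I.F, ({v} : Set α) ⊆ I.F := fun v hv => by simpa using hv
  have hNS : ∀ v ∈ I.F, I.NS v = {z | I.G.Adj v z} := by
    intro v hv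
    ext z
    refine ⟨fun h => h.2, fun h => ⟨?_, h⟩⟩
    by_contra hz
    exact hind v hv z ⟨Graph.Adj.right_mem h, hz⟩ h
  have hatt : ∀ v, I.attachments {v} = I.NS v := by
    intro v
    simp [K4Cover.Instance.attachments, K4Cover.Instance.NS]
  have hcard : ∀ v ∈ I.F, (I.NS v).ncard = 2 := by
    intro v hv
    refine le_antisymm ?_ ?_
    · rw [← hatt v]
      exact hbr.ncard_attachments_le_two (hsub v hv) (K4Cover.connected_induce_singleton v)
    · rw [hNS v hv]
      exact hred.two_le_ncard_adj hv
  refine ⟨hind, hcard, fun v hv => ?_, fun v hv h => ?_⟩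
  · obtain ⟨s, t, hst, h⟩ := Set.ncard_eq_two.1 (hcard v hv)
    obtain ⟨B, hB, hs, ht⟩ := hbr.exists_isBlock (hsub v hv)
      (K4Cover.connected_induce_singleton v) (s := s) (t := t) (by simp [hatt, h])
      (by simp [hatt, h]) hst
    exact ⟨B, hB, by simp [h, Set.insert_subset_iff, hs, ht]⟩
  · exact (hbr {v} (hsub v hv) (K4Cover.isConnected_induce_iff.2
      (K4Cover.connected_induce_singleton v))).1
      ⟨hsub v hv, K4Cover.hasK4Subdivision_of_hasK4Model h.hasK4Model⟩
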